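/- Let $n\ge 3$ and let $T\subset\mathbb R^2$ be a (closed) convex $n$-gon with vertices $\mathbf a_1,\dots,\mathbf a_n$ in counterclockwise order (indices modulo $n$) and interior angles $\theta_i\in(0,\pi)$ at $\mathbf a_i$. Let $\mathbf n_i$ be the outward unit normal of the edge $[\mathbf a_i,\mathbf a_{i+1}]$ and $h_{i,T}(\mathbf x)=(\mathbf a_i-\mathbf x)\cdot\mathbf n_i$. Let $h_T$ be the diameter of $T$, $\rho_T$ the diameter of the largest disk contained in $T$, and $h_{*,T}=\min_{i}\min_{j\ne i-1,i}h_{j,T}(\mathbf a_i)$. The Wachspress coordinates of $T$ are $$\lambda_{i,T}=\frac{w_{i,T}}{\sum_{j=1}^n w_{j,T}},\qquad w_{i,T}(\mathbf x)=(\mathbf n_{i-1}\times\mathbf n_i)\prod_{j\ne i-1,i}h_{j,T}(\mathbf x),$$ where $\mathbf y\times\mathbf z=y_1z_2-y_2z_1$. Let $\widehat T$ be a (closed) regular $n$-gon of diameter $1$ with vertices in counterclockwise order, let $\lambda_{i,\widehat T}$ be its Wachspress coordinates, and let $$F_T(\hat{\mathbf x})=\sum_{i=1}^n\lambda_{i,\widehat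 T}(\hat{\mathbf x})\,\mathbf a_i$$ be the Wachspress map from $\widehat T$ onto $T$, with Jacobian matrix $J_F$. Let $C_1>0$, $C_2>0$ and $\theta^*<\pi$. Then there are constants $c,C>0$, depending only on $C_1$, $C_2$ and $\theta^*$ (in particular not on $n$, $T$, $\widehat T$ or the point $\hat{\mathbf x}$), such that for every $n\ge3$, every convex $n$-gon $T$ with $$h_T\le C_1\rho_T,\qquad h_{*,T}\ge C_2h_T,\qquad \theta_i\le\theta^*\quad(1\le i\le n),$$ and every $\widehat T$ as above, the map $F_T$ is differentiable at every $\hat{\mathbf x}\in\widehat T$ (the formula for $F_T$ being used in a neighbourhood of $\widehat T$) and $$c\,h_T^2\le\det J_F(\hat{\mathbf x})\le C\,h_T^2\qquad\text{for all }\hat{\mathbf x}\in\widehat T.$$ -/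

import Mathlib

noncomputable section

/-- The Euclidean plane. -/
abbrev Plane : Type := EuclideanSpace ℝ (Fin 2)

/-- The planar cross product `y × z = y₁ z₂ - y₂ z₁`. -/
def cross (y z : Plane) : ℝ := y 0 * z 1 - y 1 * z 0

/-- A (strictly) convex `n`-gon, `n ≥ 3`, given by its vertices `a i` in counterclockwise order.
Indices are cyclic: `i + 1` and `i - 1` are taken modulo `n`. The field `convex` says that every
vertex other than the endpoints of the edge `[a i, a (i+1)]` lies strictly to the left of
that directed edge; in particular all interior angles are smaller than `π`. -/
structure ConvexPolygon (n : ℕ) [NeZero n] where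
  a : Fin n → Plane
  three_le : 3 ≤ n
  convex : ∀ i j : Fin n, j ≠ i → j ≠ i + 1 → 0 < cross (a (i + 1) - a i) (a j - a i)

namespace ConvexPolygon

variable {n : ℕ} [NeZero n]

/-- The closed region bounded by the polygon. -/
def carrier (T : ConvexPolygon n) : Set Plane := convexHull ℝ (Set.range T.a)

/-- The diameter `h_T`. -/
def diam (T : ConvexPolygon n) : ℝ := Metric.diam T.carrier

/-- `ρ_T`, the diameter `2 r` of the largest disk inscribed in the polygon. -/
def inDiam (T : ConvexPolygon n) : ℝ :=
  sSup {d : ℝ | ∃ (c : Plane) (r : ℝ), 0 ≤ r ∧ Metric.closedBall c r ⊆ T.carrier ∧ d = 2 * r}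

/-- The interior angle `θ_i` at the vertex `a i`. -/
def interiorAngle (T : ConvexPolygon n) (i : Fin n) : ℝ :=
  EuclideanGeometry.angle (T.a (i - 1)) (T.a i) (T.a (i + 1))

/-- The outward unit normal of the edge `e_i = [a i, a (i+1)]`: the edge vector rotated clockwise
by a right angle and normalized (the vertices run counterclockwise). -/
def normal (T : ConvexPolygon n) (i : Fin n) : Plane :=
  ‖T.a (i + 1) - T.a i‖⁻¹ • !₂[(T.a (i + 1) - T.a i) 1, -(T.a (i + 1) - T.a i) 0]

/-- `h_i(x) = (a_i - x) · n_i`; for `x` in the polygon, the distance to the line of the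
edge `e_i`. -/
def edgeDist (T : ConvexPolygon n) (i : Fin n) (x : Plane) : ℝ :=
  inner ℝ (T.a i - x) (T.normal i)

/-- `h_{*,T}`: the minimum over all `i` and all `j ≠ i - 1, i` of `h_j(a_i)`. -/
def minEdgeDist (T : ConvexPolygon n) : ℝ :=
  ⨅ i : Fin n, ⨅ j : {j : Fin n // j ≠ i - 1 ∧ j ≠ i}, T.edgeDist j (T.a i)

/-- The Wachspress weight `w_i(x) = (n_{i-1} × n_i) ∏_{j ≠ i-1, i} h_j(x)`. -/
def weight (T : ConvexPolygon n) (i : Fin n) (x : Plane) : ℝ :=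
  cross (T.normal (i - 1)) (T.normal i) *
    ∏ j ∈ Finset.univ.filter (fun j : Fin n => j ≠ i - 1 ∧ j ≠ i), T.edgeDist j x

/-- The Wachspress coordinate `λ_i = w_i / ∑_j w_j`. -/
def wachspress (T : ConvexPolygon n) (i : Fin n) (x : Plane) : ℝ :=
  T.weight i x / ∑ j : Fin n, T.weight j x

/-- The polygon is a regular `n`-gon: its vertices are `c + R (cos (φ + 2πi/n), sin (φ + 2πi/n))`
for some centre `c`, radius `R > 0` and angle `φ`. -/
def IsRegular (T : ConvexPolygon n) : Prop :=
  ∃ (c : Plane) (R φ : ℝ), 0 < R ∧ ∀ i : Fin n,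
    T.a i = c + R • !₂[Real.cos (φ + 2 * Real.pi * (i : ℕ) / n),
      Real.sin (φ + 2 * Real.pi * (i : ℕ) / n)]

/-- The Wachspress map `F(x) = ∑_i λ_{i, ref}(x) a_i` from the polygon `ref` onto `T`. The formula is
used on the whole plane. As a rational map without poles on the closed polygon `ref`, it is smooth
near `ref`, so that derivatives at boundary points of `ref` make sense. -/
def wachspressMap (ref T : ConvexPolygon n) (x : Plane) : Plane :=
  ∑ i : Fin n, ref.wachspress i x • T.a i

end ConvexPolygon

/-- The Jacobian matrix `(∂_s F_r (x))_{r, s}`. -/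
def jacobianMatrix (F : Plane → Plane) (x : Plane) : Matrix (Fin 2) (Fin 2) ℝ :=
  Matrix.of fun r s => fderiv ℝ F x (EuclideanSpace.single s 1) r

end

/-! Write h_r for the edge distances of the regular polygon, and fix an interior point x. The
logarithmic gradient of w_i is q_i = n_{i-1}/h_{i-1} + n_i/h_i minus a sum over all edges that is
the same for every i. Cauchy–Binet (`cross_sum_eq_sum_triArea`) then gives 6 det J_F as the sum over
i, j, k of λ_i λ_j λ_k [q_i q_j q_k][a_i a_j a_k], brackets being doubled signed areas. The points
n_r/h_r are the vertices of the polar dual about x, a convex polygon in the same cyclic order, and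
the q_i are its doubled edge midpoints. Both brackets therefore never have opposite signs, and every
term is nonnegative.

For the lower bound one term suffices (`le_det_jacobianMatrix_interior`). Some vertex m has all
edges but its own two at distance at least κ/n from x. For the triple m-1, m, m+1 the dual bracket
is at least a constant over h_{m-1} h_m h_{m+1}, and the three coordinates together supply the same
product as a factor, so the degeneration at the boundary cancels. Boundary points follow by
continuity. The upper bound estimates the gradients of the λ_i directly.

These constants depend on n. Uniformity holds because the vertices of T are separated by C₂ h_T,
which bounds n (`exists_card_bound`), and because all regular n-gons of diameter 1 with the same n
share one κ. -/

/-! ### Planar algebra of cross products and signed areas -/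

theorem Plane.inner_eq (u v : Plane) : inner ℝ u v = u 0 * v 0 + u 1 * v 1 := by
  simp [PiLp.inner_apply, Fin.sum_univ_two, mul_comm]

theorem Plane.norm_sq_eq (u : Plane) : ‖u‖ ^ 2 = u 0 ^ 2 + u 1 ^ 2 := by
  rw [← real_inner_self_eq_norm_sq, Plane.inner_eq]; ring

theorem abs_cross_le (u v : Plane) : |cross u v| ≤ ‖u‖ * ‖v‖ := by
  apply abs_le_of_sq_le_sq _ (by positivity)
  rw [mul_pow, Plane.norm_sq_eq, Plane.norm_sq_eq, cross]
  nlinarith [sq_nonneg (u 0 * v 0 + u 1 * v 1)]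

/-- Twice the signed area of the triangle `u v w`. -/
def triArea (u v w : Plane) : ℝ := cross (v - u) (w - u)

theorem triArea_rotate (u v w : Plane) : triArea u v w = triArea v w u := by
  simp only [triArea, cross, PiLp.sub_apply]; ring

theorem triArea_swap (u v w : Plane) : triArea u w v = -triArea u v w := by
  simp only [triArea, cross, PiLp.sub_apply]; ring

@[simp] theorem triArea_self_left (u v : Plane) : triArea u u v = 0 := by
  simp [triArea, cross]

@[simp] theorem triArea_self_right (u v : Plane) : triArea u v v = 0 := by
  simp only [triArea, cross, PiLp.sub_apply]; ring

@[simp] theorem triArea_self_outer (u v : Plane) : triArea u v u = 0 := by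
  simp [triArea, cross]

/-- The three-term Grassmann–Plücker relation for the vectors from `i` to the other four points. It
propagates orientation from edges to arbitrary triples. -/
theorem triArea_plucker (i e j k l : Plane) :
    triArea i e k * triArea i j l =
      triArea i e j * triArea i k l + triArea i e l * triArea i j k := by
  simp only [triArea, cross, PiLp.sub_apply]; ring

/-- The signed area is affine in each argument, so the triangle of midpoints has the mean of the
eight areas; doubling the points multiplies it by 4, and 4/8 = 1/2. -/
theorem triArea_add (a b c d e f : Plane) :
    triArea (a + b) (c + d) (e + f) =
      (triArea a c e + triArea a c f + triArea a d e + triArea a d f +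
        triArea b c e + triArea b c f + triArea b d e + triArea b d f) / 2 := by
  simp only [triArea, cross, PiLp.sub_apply, PiLp.add_apply]; ring

/-- Each factor is alternating, so the product is symmetric in the indices and they may be sorted.
-/
theorem triArea_mul_triArea_nonneg {ι : Type*} [LinearOrder ι] {A B : ι → Plane}
    (hA : ∀ i j k, i < j → j < k → 0 ≤ triArea (A i) (A j) (A k))
    (hB : ∀ i j k, i < j → j < k → 0 ≤ triArea (B i) (B j) (B k)) (i j k : ι) :
    0 ≤ triArea (A i) (A j) (A k) * triArea (B i) (B j) (B k) := by
  have base : ∀ i j k, i < j → j < k →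
      0 ≤ triArea (A i) (A j) (A k) * triArea (B i) (B j) (B k) :=
    fun i j k h h' => mul_nonneg (hA i j k h h') (hB i j k h h')
  have swap : ∀ i j k, triArea (A i) (A k) (A j) * triArea (B i) (B k) (B j) =
      triArea (A i) (A j) (A k) * triArea (B i) (B j) (B k) := by
    intro i j k; rw [triArea_swap, triArea_swap (B i)]; ring
  have rot : ∀ i j k, triArea (A i) (A j) (A k) * triArea (B i) (B j) (B k) =
      triArea (A j) (A k) (A i) * triArea (B j) (B k) (B i) := by
    intro i j k; rw [triArea_rotate, triArea_rotate (B i)]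
  have least : ∀ i j k, i < j → i < k →
      0 ≤ triArea (A i) (A j) (A k) * triArea (B i) (B j) (B k) := by
    intro i j k h h'
    rcases lt_trichotomy j k with hjk | rfl | hjk
    · exact base i j k h hjk
    · simp
    · rw [← swap]; exact base i k j h' hjk
  rcases lt_trichotomy i j with hij | rfl | hij
  · rcases lt_trichotomy i k with hik | rfl | hik
    · exact least i j k hij hik
    · simp
    · rw [rot, rot]; exact least k i j hik (hik.trans hij)
  · simp
  · rcases lt_trichotomy j k with hjk | rfl | hjk
    · rw [rot]; exact least j k i hjk hij
    · simp
    · rw [rot, rot]; exact least k i j (hjk.trans hij) hjk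

/-! ### Cyclic order and orientation of the vertices -/

namespace ConvexPolygon

variable {n : ℕ} [NeZero n]

theorem add_one_ne (T : ConvexPolygon n) (i : Fin n) : i + 1 ≠ i := by
  have h3 := T.three_le
  obtain ⟨m, rfl⟩ : ∃ m, n = m + 3 := ⟨n - 3, by omega⟩
  simp

theorem sub_one_ne (T : ConvexPolygon n) (i : Fin n) : i - 1 ≠ i := by
  have h3 := T.three_le
  obtain ⟨m, rfl⟩ : ∃ m, n = m + 3 := ⟨n - 3, by omega⟩
  simp

theorem add_one_ne_sub_one (T : ConvexPolygon n) (i : Fin n) : i + 1 ≠ i - 1 := by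
  have h3 := T.three_le
  obtain ⟨m, rfl⟩ : ∃ m, n = m + 3 := ⟨n - 3, by omega⟩
  intro h
  have h2 : (1 : Fin (m + 3)) + 1 = 0 := by
    have := congrArg (fun z => z + 1 - i) h
    simpa [add_comm, add_left_comm, add_assoc, sub_eq_add_neg] using this
  have := congrArg Fin.val h2
  simp only [Fin.val_add, Fin.val_one, Fin.val_zero, Nat.reduceAdd] at this
  rw [Nat.mod_eq_of_lt (by omega)] at this
  omega

theorem triArea_edge_nonneg (T : ConvexPolygon n) (i j : Fin n) :
    0 ≤ triArea (T.a i) (T.a (i + 1)) (T.a j) := by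
  by_cases h : j = i
  · simp [h]
  by_cases h' : j = i + 1
  · simp [h']
  exact (T.convex i j h h').le

/-- Convexity only orients triples containing an edge. Induction on the gap between `j` and `k`
handles the rest, using the Plücker relation with the edge from `i` to `i + 1`. -/
theorem triArea_pos (T : ConvexPolygon n) {i j k : Fin n} (hij : i < j) (hjk : j < k) :
    0 < triArea (T.a i) (T.a j) (T.a k) := by
  have succ_eq : ∀ a b : Fin n, a.val + 1 = b.val → b = a + 1 := by
    intro a b h
    apply Fin.ext
    have h3 := T.three_le
    have hb := b.isLt
    rw [Fin.val_add, Fin.val_one', Nat.mod_eq_of_lt (show 1 < n by omega),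
      Nat.mod_eq_of_lt (by omega), h]
  have key : ∀ d : ℕ, ∀ k : Fin n, k.val = j.val + 1 + d →
      0 < triArea (T.a i) (T.a j) (T.a k) := by
    have cons : ∀ a b : Fin n, i < a → a.val + 1 = b.val →
        0 < triArea (T.a i) (T.a a) (T.a b) := by
      intro a b hia hab
      rw [triArea_rotate, succ_eq a b hab]
      refine T.convex a i hia.ne ?_
      rw [← succ_eq a b hab]
      intro h
      rw [h, Fin.lt_def] at hia
      omega
    intro d
    induction d with
    | zero => intro k hk; exact cons j k hij (by omega)
    | succ d ih =>
      intro l hl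
      have hl' := l.isLt
      have hij' := Fin.lt_def.1 hij
      let k : Fin n := ⟨j.val + 1 + d, by omega⟩
      let e : Fin n := ⟨i.val + 1, by omega⟩
      have he : e = i + 1 := succ_eq i e rfl
      have hk := ih k rfl
      have hkl := cons k l (by rw [Fin.lt_def]; simp only [k]; omega) (by simp only [k]; omega)
      have pos : ∀ b : Fin n, e < b → 0 < triArea (T.a i) (T.a e) (T.a b) := by
        intro b hb
        rw [he]
        rw [Fin.lt_def] at hb
        refine T.convex i b ?_ ?_
        · rintro rfl; simp only [e] at hb; omega
        · rintro h; rw [← he] at h; rw [h] at hb; omega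
      have hek := pos k (by rw [Fin.lt_def]; simp only [k, e]; omega)
      have hel := pos l (by rw [Fin.lt_def]; simp only [e]; omega)
      -- Only weak positivity: `j` may equal `e`. The other summand of the relation is strictly
      -- positive.
      have hej : 0 ≤ triArea (T.a i) (T.a e) (T.a j) := by
        rw [he]; exact T.triArea_edge_nonneg i j
      have pl := triArea_plucker (T.a i) (T.a e) (T.a j) (T.a k) (T.a l)
      have : 0 < triArea (T.a i) (T.a e) (T.a k) * triArea (T.a i) (T.a j) (T.a l) := by
        rw [pl]; positivity
      exact pos_of_mul_pos_right this hek.le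
  have := Fin.lt_def.1 hjk
  exact key (k.val - j.val - 1) k (by omega)

theorem triArea_nonneg (T : ConvexPolygon n) {i j k : Fin n} (hij : i ≤ j) (hjk : j ≤ k) :
    0 ≤ triArea (T.a i) (T.a j) (T.a k) := by
  rcases hij.eq_or_lt with rfl | hij
  · simp
  rcases hjk.eq_or_lt with rfl | hjk
  · simp
  exact (T.triArea_pos hij hjk).le

theorem val_sub_one (T : ConvexPolygon n) {i : Fin n} (hi : i ≠ 0) :
    (i - 1).val = i.val - 1 := by
  have h3 := T.three_le
  obtain ⟨m, rfl⟩ : ∃ m, n = m + 1 := ⟨n - 1, by omega⟩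
  rw [Fin.coe_sub_one, if_neg hi]

theorem zero_sub_one_val (T : ConvexPolygon n) : ((0 : Fin n) - 1).val = n - 1 := by
  have h3 := T.three_le
  obtain ⟨m, rfl⟩ : ∃ m, n = m + 1 := ⟨n - 1, by omega⟩
  rw [Fin.coe_sub_one, if_pos rfl]; simp

/-- The doubled edge midpoints of a convex polygon are in counterclockwise order. -/
theorem triArea_midpoints_nonneg (T : ConvexPolygon n) {i j k : Fin n}
    (hij : i < j) (hjk : j < k) :
    0 ≤ triArea (T.a (i - 1) + T.a i) (T.a (j - 1) + T.a j) (T.a (k - 1) + T.a k) := by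
  have hij' := Fin.lt_def.1 hij
  have hjk' := Fin.lt_def.1 hjk
  have hj0 : j ≠ 0 := by rintro rfl; simp at hij
  have hk0 : k ≠ 0 := by rintro rfl; simp at hjk
  have hj := T.val_sub_one hj0
  have hk := T.val_sub_one hk0
  have upper : ∀ b ∈ ({j - 1, j} : Set (Fin n)), ∀ c ∈ ({k - 1, k} : Set (Fin n)),
      i ≤ b ∧ b ≤ c := by
    rintro b (rfl | rfl) c (rfl | rfl) <;> simp only [Fin.le_def] <;> omega
  have all : ∀ a ∈ ({i - 1, i} : Set (Fin n)), ∀ b ∈ ({j - 1, j} : Set (Fin n)),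
      ∀ c ∈ ({k - 1, k} : Set (Fin n)), 0 ≤ triArea (T.a a) (T.a b) (T.a c) := by
    intro a ha b hb c hc
    obtain ⟨h1, h2⟩ := upper b hb c hc
    rcases ha with rfl | rfl
    · by_cases hi : i = 0
      -- The predecessor of 0 is the last index, so rotation restores the increasing order.
      · rw [triArea_rotate]
        refine T.triArea_nonneg h2 ?_
        have := c.isLt
        rw [Fin.le_def, hi, T.zero_sub_one_val]; omega
      · refine T.triArea_nonneg (le_trans ?_ h1) h2
        rw [Fin.le_def, T.val_sub_one hi]; omega
    · exact T.triArea_nonneg h1 h2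
  rw [triArea_add]
  have := all (i - 1) (by simp) (j - 1) (by simp) (k - 1) (by simp)
  have := all (i - 1) (by simp) (j - 1) (by simp) k (by simp)
  have := all (i - 1) (by simp) j (by simp) (k - 1) (by simp)
  have := all (i - 1) (by simp) j (by simp) k (by simp)
  have := all i (by simp) (j - 1) (by simp) (k - 1) (by simp)
  have := all i (by simp) (j - 1) (by simp) k (by simp)
  have := all i (by simp) j (by simp) (k - 1) (by simp)
  have := all i (by simp) j (by simp) k (by simp)
  linarith

theorem sub_add_one (i : Fin n) : i - 1 + 1 = i := by
  obtain ⟨m, rfl⟩ : ∃ m, n = m + 1 := ⟨n - 1, by have := NeZero.pos n; omega⟩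
  exact sub_add_cancel i 1

theorem add_sub_one (i : Fin n) : i + 1 - 1 = i := by
  obtain ⟨m, rfl⟩ : ∃ m, n = m + 1 := ⟨n - 1, by have := NeZero.pos n; omega⟩
  exact add_sub_cancel_right i 1

/-- Of the eight areas in the expansion four vanish, and the remaining ones each contain an edge,
hence are nonnegative; only the triangle at `m` is kept. -/
theorem triArea_consecutive_midpoints (T : ConvexPolygon n) (m : Fin n) :
    triArea (T.a (m - 1)) (T.a m) (T.a (m + 1)) / 2 ≤
      triArea (T.a (m - 1 - 1) + T.a (m - 1)) (T.a (m - 1) + T.a m)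
        (T.a (m + 1 - 1) + T.a (m + 1)) := by
  rw [add_sub_one, triArea_add]
  have h1 := T.triArea_edge_nonneg (m - 1 - 1) m
  have h2 := T.triArea_edge_nonneg (m - 1 - 1) (m + 1)
  have h3 := T.triArea_edge_nonneg m (m - 1 - 1)
  rw [← triArea_rotate] at h3
  rw [sub_add_one] at h1 h2
  simp only [triArea_self_left, triArea_self_right]
  linarith

/-! ### Normals and distances to the edge lines -/

theorem edge_norm_pos (T : ConvexPolygon n) (i : Fin n) : 0 < ‖T.a (i + 1) - T.a i‖ := by
  rw [norm_pos_iff]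
  intro h
  have h1 : i - 1 ≠ i + 1 := (T.add_one_ne_sub_one i).symm
  have := T.convex i (i - 1) (T.sub_one_ne i) h1
  rw [h] at this
  simp [cross] at this

theorem normal_zero (T : ConvexPolygon n) (i : Fin n) :
    T.normal i 0 = ‖T.a (i + 1) - T.a i‖⁻¹ * (T.a (i + 1) - T.a i) 1 := by
  simp [normal]

theorem normal_one (T : ConvexPolygon n) (i : Fin n) :
    T.normal i 1 = -(‖T.a (i + 1) - T.a i‖⁻¹ * (T.a (i + 1) - T.a i) 0) := by
  rw [← mul_neg]; rfl

theorem norm_normal (T : ConvexPolygon n) (i : Fin n) : ‖T.normal i‖ = 1 := by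
  have h := T.edge_norm_pos i
  have h2 : ‖T.normal i‖ ^ 2 = 1 := by
    rw [Plane.norm_sq_eq, normal_zero, normal_one]
    have := Plane.norm_sq_eq (T.a (i + 1) - T.a i)
    have h3 : ‖T.a (i + 1) - T.a i‖⁻¹ ^ 2 * ‖T.a (i + 1) - T.a i‖ ^ 2 = 1 := by
      rw [← mul_pow, inv_mul_cancel₀ h.ne', one_pow]
    rw [this] at h3
    linarith
  nlinarith [norm_nonneg (T.normal i)]

theorem edgeDist_eq_cross (T : ConvexPolygon n) (i : Fin n) (x : Plane) :
    T.edgeDist i x = ‖T.a (i + 1) - T.a i‖⁻¹ * cross (T.a (i + 1) - T.a i) (x - T.a i) := by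
  rw [edgeDist, Plane.inner_eq, normal_zero, normal_one]
  simp only [cross, PiLp.sub_apply]
  ring

theorem edgeDist_eq_add (T : ConvexPolygon n) (i : Fin n) (x y : Plane) :
    T.edgeDist i x = T.edgeDist i y + inner ℝ (y - x) (T.normal i) := by
  rw [edgeDist, edgeDist, ← inner_add_left, sub_add_sub_cancel]

theorem edgeDist_vertex_pos (T : ConvexPolygon n) {i j : Fin n} (h : j ≠ i) (h' : j ≠ i + 1) :
    0 < T.edgeDist i (T.a j) := by
  rw [edgeDist_eq_cross]
  exact mul_pos (inv_pos.2 (T.edge_norm_pos i)) (T.convex i j h h')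

@[simp] theorem edgeDist_self (T : ConvexPolygon n) (i : Fin n) : T.edgeDist i (T.a i) = 0 := by
  simp [edgeDist]

@[simp] theorem edgeDist_succ (T : ConvexPolygon n) (i : Fin n) :
    T.edgeDist i (T.a (i + 1)) = 0 := by
  rw [edgeDist_eq_cross]
  simp [cross, mul_comm]

theorem edgeDist_vertex_nonneg (T : ConvexPolygon n) (i j : Fin n) :
    0 ≤ T.edgeDist i (T.a j) := by
  by_cases h : j = i
  · simp [h]
  by_cases h' : j = i + 1
  · simp [h']
  exact (T.edgeDist_vertex_pos h h').le

theorem edgeDist_le_dist (T : ConvexPolygon n) (i : Fin n) (x y : Plane) (hy : T.edgeDist i y = 0) :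
    T.edgeDist i x ≤ dist y x := by
  rw [T.edgeDist_eq_add i x y, hy, zero_add, dist_eq_norm]
  simpa [T.norm_normal] using real_inner_le_norm (y - x) (T.normal i)

/-- The cross product of consecutive normals is the sine of the exterior angle, so this is the
height of a right triangle. -/
theorem edgeDist_eq_norm_mul_cross (T : ConvexPolygon n) (i : Fin n) :
    T.edgeDist i (T.a (i - 1)) =
      ‖T.a i - T.a (i - 1)‖ * cross (T.normal (i - 1)) (T.normal i) := by
  simp only [edgeDist_eq_cross, cross, normal_zero, normal_one, sub_add_one]
  have h : ‖T.a i - T.a (i - 1)‖ ≠ 0 := by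
    have := T.edge_norm_pos (i - 1)
    rw [sub_add_one] at this
    exact this.ne'
  field_simp
  simp only [PiLp.sub_apply]
  ring

theorem cross_normal_pos (T : ConvexPolygon n) (i : Fin n) :
    0 < cross (T.normal (i - 1)) (T.normal i) := by
  have h := T.edgeDist_vertex_pos (T.sub_one_ne i) (T.add_one_ne_sub_one i).symm
  rw [edgeDist_eq_norm_mul_cross] at h
  exact pos_of_mul_pos_right h (norm_nonneg _)

theorem cross_normal_le_one (T : ConvexPolygon n) (i j : Fin n) :
    cross (T.normal i) (T.normal j) ≤ 1 := by
  have := abs_cross_le (T.normal i) (T.normal j)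
  rw [T.norm_normal, T.norm_normal, one_mul] at this
  exact (abs_le.1 this).2

/-! ### The polar dual polygon -/

/-- The determinant of three edge lines; it does not depend on the point `x`. -/
noncomputable def lineDet (T : ConvexPolygon n) (i j k : Fin n) (x : Plane) : ℝ :=
  T.edgeDist k x * cross (T.normal i) (T.normal j) +
    T.edgeDist i x * cross (T.normal j) (T.normal k) +
    T.edgeDist j x * cross (T.normal k) (T.normal i)

theorem lineDet_eq (T : ConvexPolygon n) (i j k : Fin n) (x y : Plane) :
    T.lineDet i j k x = T.lineDet i j k y := by
  rw [lineDet, T.edgeDist_eq_add i x y, T.edgeDist_eq_add j x y, T.edgeDist_eq_add k x y, lineDet]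
  simp only [Plane.inner_eq, cross]
  ring

/-- Evaluation at the common vertex of the two consecutive edges kills two of the three summands. -/
theorem lineDet_consecutive (T : ConvexPolygon n) (i k : Fin n) (x : Plane) :
    T.lineDet (i - 1) i k x = T.edgeDist k (T.a i) * cross (T.normal (i - 1)) (T.normal i) := by
  have h : T.edgeDist (i - 1) (T.a i) = 0 := by
    have := T.edgeDist_succ (i - 1)
    rwa [sub_add_one] at this
  rw [T.lineDet_eq _ _ _ x (T.a i), lineDet, h, edgeDist_self]
  ring

theorem triArea_inv_smul_normal (T : ConvexPolygon n) {x : Plane} (hx : ∀ r, 0 < T.edgeDist r x)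
    (i j k : Fin n) :
    triArea ((T.edgeDist i x)⁻¹ • T.normal i) ((T.edgeDist j x)⁻¹ • T.normal j)
        ((T.edgeDist k x)⁻¹ • T.normal k) =
      T.lineDet i j k x / (T.edgeDist i x * T.edgeDist j x * T.edgeDist k x) := by
  have hi := (hx i).ne'
  have hj := (hx j).ne'
  have hk := (hx k).ne'
  simp only [triArea, cross, lineDet, PiLp.sub_apply, PiLp.smul_apply, smul_eq_mul]
  field_simp
  ring

/-- The polar dual of a convex polygon with respect to an interior point. -/
noncomputable def polarDual (T : ConvexPolygon n) (x : Plane) (hx : ∀ r, 0 < T.edgeDist r x) :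
    ConvexPolygon n where
  a r := (T.edgeDist r x)⁻¹ • T.normal r
  three_le := T.three_le
  convex i j h h' := by
    change 0 < triArea _ _ _
    rw [T.triArea_inv_smul_normal hx]
    have := hx i
    have := hx j
    have := hx (i + 1)
    -- Edges `i` and `i + 1` meet at `a (i + 1)`, so convexity of the dual amounts to this vertex
    -- lying strictly inside the line of edge `j`.
    have h2 := T.lineDet_consecutive (i + 1) j x
    rw [add_sub_one] at h2
    rw [h2]
    have h3 := T.cross_normal_pos (i + 1)
    rw [add_sub_one] at h3
    have h4 : 0 < T.edgeDist j (T.a (i + 1)) := by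
      refine T.edgeDist_vertex_pos h'.symm fun h5 => h ?_
      have := congrArg (fun z => z - 1) h5
      simpa [add_sub_one] using this.symm
    positivity

/-! Points of the polygon. -/

theorem edgeDist_sum (T : ConvexPolygon n) (r : Fin n) {μ : Fin n → ℝ} {y : Fin n → Plane}
    (hμ : ∑ i, μ i = 1) :
    T.edgeDist r (∑ i, μ i • y i) = ∑ i, μ i * T.edgeDist r (y i) := by
  have h : T.a r - ∑ i, μ i • y i = ∑ i, μ i • (T.a r - y i) := by
    simp only [smul_sub, Finset.sum_sub_distrib, ← Finset.sum_smul, hμ, one_smul]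
  rw [edgeDist, h, sum_inner]
  simp only [real_inner_smul_left, edgeDist]

theorem mem_carrier_iff (T : ConvexPolygon n) {x : Plane} :
    x ∈ T.carrier ↔ ∃ μ : Fin n → ℝ, (∀ i, 0 ≤ μ i) ∧ ∑ i, μ i = 1 ∧ ∑ i, μ i • T.a i = x := by
  constructor
  · intro hx
    have hconv : Convex ℝ ((fun μ : Fin n → ℝ => ∑ i, μ i • T.a i) '' stdSimplex ℝ (Fin n)) := by
      refine (convex_stdSimplex ℝ (Fin n)).is_linear_image ⟨fun μ ν => ?_, fun s μ => ?_⟩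
      · simp only [Pi.add_apply, add_smul, Finset.sum_add_distrib]
      · simp only [Pi.smul_apply, smul_assoc, Finset.smul_sum]
    have hsub : Set.range T.a ⊆ (fun μ : Fin n → ℝ => ∑ i, μ i • T.a i) '' stdSimplex ℝ (Fin n) := by
      rintro _ ⟨i, rfl⟩
      exact ⟨Pi.single i 1, single_mem_stdSimplex ℝ i, by simp [Pi.single_apply]⟩
    obtain ⟨μ, hμ, rfl⟩ := convexHull_min hsub hconv hx
    exact ⟨μ, hμ.1, hμ.2, rfl⟩
  · rintro ⟨μ, h0, h1, rfl⟩
    exact (convex_convexHull ℝ _).sum_mem (fun i _ => h0 i) h1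
      fun i _ => subset_convexHull ℝ _ ⟨i, rfl⟩

theorem vertex_mem_carrier (T : ConvexPolygon n) (i : Fin n) : T.a i ∈ T.carrier :=
  subset_convexHull ℝ _ ⟨i, rfl⟩

theorem isBounded_carrier (T : ConvexPolygon n) : Bornology.IsBounded T.carrier :=
  (isBounded_convexHull).2 (Set.finite_range _).isBounded

theorem dist_le_diam (T : ConvexPolygon n) {x y : Plane} (hx : x ∈ T.carrier)
    (hy : y ∈ T.carrier) : dist x y ≤ T.diam :=
  Metric.dist_le_diam_of_mem T.isBounded_carrier hx hy

theorem edgeDist_nonneg (T : ConvexPolygon n) (r : Fin n) {x : Plane} (hx : x ∈ T.carrier) :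
    0 ≤ T.edgeDist r x := by
  obtain ⟨μ, h0, h1, rfl⟩ := T.mem_carrier_iff.1 hx
  rw [T.edgeDist_sum r h1]
  exact Finset.sum_nonneg fun i _ => mul_nonneg (h0 i) (T.edgeDist_vertex_nonneg r i)

theorem edgeDist_le_diam (T : ConvexPolygon n) (r : Fin n) {x : Plane} (hx : x ∈ T.carrier) :
    T.edgeDist r x ≤ T.diam :=
  (T.edgeDist_le_dist r x (T.a r) (T.edgeDist_self r)).trans
    (T.dist_le_diam (T.vertex_mem_carrier r) hx)

/-- Every point of the polygon keeps a distance from all edge lines except the two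
through a suitable vertex. -/
theorem exists_vertex_edgeDist_ge (T : ConvexPolygon n) {κ : ℝ}
    (hT : ∀ i j : Fin n, j ≠ i - 1 → j ≠ i → κ ≤ T.edgeDist j (T.a i)) {x : Plane}
    (hx : x ∈ T.carrier) :
    ∃ m : Fin n, ∀ r, r ≠ m - 1 → r ≠ m → κ / n ≤ T.edgeDist r x := by
  obtain ⟨μ, h0, h1, rfl⟩ := T.mem_carrier_iff.1 hx
  have hn : (0 : ℝ) < n := by exact_mod_cast NeZero.pos n
  -- The `n` barycentric coefficients sum to 1, so one is at least 1/n.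
  obtain ⟨m, -, hm⟩ : ∃ m ∈ Finset.univ, (n : ℝ)⁻¹ ≤ μ m := by
    apply Finset.exists_le_of_sum_le ⟨0, Finset.mem_univ _⟩
    rw [h1]
    simp [hn.ne']
  refine ⟨m, fun r hr hr' => ?_⟩
  rw [T.edgeDist_sum r h1]
  have h2 := Finset.single_le_sum (f := fun i => μ i * T.edgeDist r (T.a i))
    (fun i _ => mul_nonneg (h0 i) (T.edgeDist_vertex_nonneg r i)) (Finset.mem_univ m)
  have h3 := T.edgeDist_vertex_nonneg r m
  calc κ / n = (n : ℝ)⁻¹ * κ := by ring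
    _ ≤ (n : ℝ)⁻¹ * T.edgeDist r (T.a m) := by
      gcongr; exact hT m r hr hr'
    _ ≤ μ m * T.edgeDist r (T.a m) := by gcongr
    _ ≤ _ := h2

/-- Points of the polygon are limits of interior points. -/
theorem mem_closure_interior_points (T : ConvexPolygon n) {x : Plane} (hx : x ∈ T.carrier) :
    x ∈ closure {y ∈ T.carrier | ∀ r, 0 < T.edgeDist r y} := by
  have hn : (0 : ℝ) < n := by exact_mod_cast NeZero.pos n
  have hsum : ∑ _i : Fin n, (n : ℝ)⁻¹ = 1 := by simp [hn.ne']
  -- The vertex centroid is strictly inside every edge line; the segment from `x` to it supplies the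
  -- approximating points.
  set g : Plane := ∑ i, (n : ℝ)⁻¹ • T.a i with hg
  have hgT : g ∈ T.carrier := T.mem_carrier_iff.2 ⟨_, fun _ => by positivity, hsum, rfl⟩
  have hgpos : ∀ r, 0 < T.edgeDist r g := by
    intro r
    rw [hg, T.edgeDist_sum r hsum]
    have hr : r - 1 ≠ r + 1 := (T.add_one_ne_sub_one r).symm
    exact Finset.sum_pos' (fun i _ => mul_nonneg (by positivity) (T.edgeDist_vertex_nonneg r i))
      ⟨r - 1, Finset.mem_univ _, mul_pos (by positivity)
        (T.edgeDist_vertex_pos (T.sub_one_ne r) hr)⟩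
  have hlim : Filter.Tendsto (fun t : ℝ => (1 - t) • x + t • g) (nhdsWithin 0 (Set.Ioo 0 1))
      (nhds x) := by
    have hc : Continuous fun t : ℝ => (1 - t) • x + t • g := by fun_prop
    have := hc.tendsto 0
    simp only [sub_zero, one_smul, zero_smul, add_zero] at this
    exact this.mono_left nhdsWithin_le_nhds
  have : (nhdsWithin (0 : ℝ) (Set.Ioo 0 1)).NeBot := by
    rw [← mem_closure_iff_nhdsWithin_neBot, closure_Ioo one_ne_zero.symm]
    simp
  refine mem_closure_of_tendsto hlim ?_
  filter_upwards [self_mem_nhdsWithin] with t ht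
  refine ⟨(convex_convexHull ℝ _) hx hgT (by linarith [ht.2]) ht.1.le (by ring), fun r => ?_⟩
  have h : T.edgeDist r ((1 - t) • x + t • g) =
      (1 - t) * T.edgeDist r x + t * T.edgeDist r g := by
    simp only [edgeDist, Plane.inner_eq, PiLp.sub_apply, PiLp.add_apply, PiLp.smul_apply,
      smul_eq_mul]
    ring
  rw [h]
  have h1 := T.edgeDist_nonneg r hx
  have h2 := mul_pos ht.1 (hgpos r)
  have h3 : 0 ≤ 1 - t := by linarith [ht.2]
  positivity

end ConvexPolygon

/-! ### The Cauchy–Binet expansion -/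

/-- Because `d₀` and `d₁` sum to zero, the base point `a i` drops out of the double sum over `j` and
`k`, and bilinearity leaves the cross product for each `i`. -/
theorem sum_mul_triArea {ι : Type*} [Fintype ι] (l d₀ d₁ : ι → ℝ) (a : ι → Plane)
    (hl : ∑ i, l i = 1) (h₀ : ∑ i, d₀ i = 0) (h₁ : ∑ i, d₁ i = 0) :
    ∑ i, ∑ j, ∑ k, l i * d₀ j * d₁ k * triArea (a i) (a j) (a k) =
      cross (∑ i, d₀ i • a i) (∑ i, d₁ i • a i) := by
  have shift : ∀ (d : ι → ℝ), ∑ i, d i = 0 → ∀ (i : ι) (s : Fin 2),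
      ∑ j, d j * (a j s - a i s) = (∑ j, d j • a j) s := by
    intro d hd i s
    simp only [mul_sub, Finset.sum_sub_distrib, ← Finset.sum_mul, hd, zero_mul, sub_zero,
      WithLp.ofLp_sum, Finset.sum_apply, PiLp.smul_apply, smul_eq_mul]
  have inner : ∀ i, ∑ j, ∑ k, l i * d₀ j * d₁ k * triArea (a i) (a j) (a k) =
      l i * cross (∑ i, d₀ i • a i) (∑ i, d₁ i • a i) := by
    intro i
    rw [cross, ← shift d₀ h₀ i, ← shift d₀ h₀ i, ← shift d₁ h₁ i, ← shift d₁ h₁ i,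
      Finset.sum_mul_sum, Finset.sum_mul_sum, ← Finset.sum_sub_distrib, Finset.mul_sum]
    refine Finset.sum_congr rfl fun j _ => ?_
    rw [← Finset.sum_sub_distrib, Finset.mul_sum]
    refine Finset.sum_congr rfl fun k _ => ?_
    simp only [triArea, cross, PiLp.sub_apply]
    ring
  simp only [inner, ← Finset.sum_mul, hl, one_mul]

/-- The Cauchy–Binet formula for weights `l i` with logarithmic derivatives `q i - K`. -/
theorem cross_sum_eq_sum_triArea {ι : Type*} [Fintype ι] (l d₀ d₁ : ι → ℝ) (a q : ι → Plane)
    (K : Plane) (hl : ∑ i, l i = 1) (h₀ : ∑ i, d₀ i = 0) (h₁ : ∑ i, d₁ i = 0)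
    (hd₀ : ∀ i, d₀ i = l i * (q i 0 - K 0)) (hd₁ : ∀ i, d₁ i = l i * (q i 1 - K 1)) :
    6 * cross (∑ i, d₀ i • a i) (∑ i, d₁ i • a i) =
      ∑ i, ∑ j, ∑ k, l i * l j * l k *
        (triArea (q i) (q j) (q k) * triArea (a i) (a j) (a k)) := by
  set X : ι → ι → ι → ℝ := fun i j k => l i * d₀ j * d₁ k * triArea (a i) (a j) (a k) with hX
  have hsum : ∑ i, ∑ j, ∑ k, X i j k = cross (∑ i, d₀ i • a i) (∑ i, d₁ i • a i) :=
    sum_mul_triArea l d₀ d₁ a hl h₀ h₁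
  -- `K` disappears since `triArea` is translation invariant. The signs of the six permutations are
  -- absorbed by the alternating area of the `a`'s, so each permutation contributes the same total.
  have hexp : ∀ i j k, l i * l j * l k *
      (triArea (q i) (q j) (q k) * triArea (a i) (a j) (a k)) =
      X i j k + X i k j + X j i k + X k i j + X j k i + X k j i := by
    intro i j k
    simp only [hX, hd₀, hd₁, triArea, cross, PiLp.sub_apply]
    ring
  have c2 : ∑ i, ∑ j, ∑ k, X i k j = ∑ i, ∑ j, ∑ k, X i j k :=
    Finset.sum_congr rfl fun i _ => Finset.sum_comm
  have c3 : ∑ i, ∑ j, ∑ k, X j i k = ∑ i, ∑ j, ∑ k, X i j k := Finset.sum_comm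
  have c4 : ∑ i, ∑ j, ∑ k, X k i j = ∑ i, ∑ j, ∑ k, X i j k := by
    rw [← c3]
    calc ∑ i, ∑ j, ∑ k, X k i j = ∑ i, ∑ k, ∑ j, X k i j :=
          Finset.sum_congr rfl fun i _ => Finset.sum_comm
      _ = _ := rfl
  have c5 : ∑ i, ∑ j, ∑ k, X j k i = ∑ i, ∑ j, ∑ k, X i j k := by
    rw [Finset.sum_comm]
    exact c2
  have c6 : ∑ i, ∑ j, ∑ k, X k j i = ∑ i, ∑ j, ∑ k, X i j k := by
    rw [Finset.sum_comm]
    exact c4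
  simp only [hexp, Finset.sum_add_distrib, c2, c3, c4, c5, c6, hsum]
  ring

/-! ### Derivatives of the Wachspress coordinates -/

namespace ConvexPolygon

variable {n : ℕ} [NeZero n]

theorem hasFDerivAt_edgeDist (T : ConvexPolygon n) (r : Fin n) (x : Plane) :
    HasFDerivAt (T.edgeDist r) (-innerSL ℝ (T.normal r)) x := by
  have h : T.edgeDist r = fun y => T.edgeDist r 0 - innerSL ℝ (T.normal r) y := by
    ext y
    rw [T.edgeDist_eq_add r y 0, innerSL_apply_apply, real_inner_comm]
    simp [sub_eq_add_neg]
  rw [h]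
  exact (innerSL ℝ (T.normal r)).hasFDerivAt.const_sub _

/-- The indices of the edges which do not contain the vertex `a i`. -/
abbrev farEdges (i : Fin n) : Finset (Fin n) :=
  Finset.univ.filter (fun j : Fin n => j ≠ i - 1 ∧ j ≠ i)

/-- The derivative of the Wachspress weight. -/
noncomputable def weightDeriv (T : ConvexPolygon n) (i : Fin n) (x : Plane) : Plane →L[ℝ] ℝ :=
  cross (T.normal (i - 1)) (T.normal i) •
    ∑ r ∈ farEdges i, (∏ j ∈ (farEdges i).erase r, T.edgeDist j x) • -innerSL ℝ (T.normal r)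

theorem hasFDerivAt_weight (T : ConvexPolygon n) (i : Fin n) (x : Plane) :
    HasFDerivAt (T.weight i) (T.weightDeriv i x) x := by
  have h := HasFDerivAt.finsetProd (u := farEdges i) (g := fun r => T.edgeDist r)
    (fun r _ => T.hasFDerivAt_edgeDist r x)
  exact h.const_mul _

theorem contDiff_weight (T : ConvexPolygon n) (i : Fin n) : ContDiff ℝ 1 (T.weight i) := by
  have h : ∀ r, ContDiff ℝ 1 (T.edgeDist r) := by
    intro r
    exact (contDiff_const.sub contDiff_id).inner ℝ contDiff_const
  exact contDiff_const.mul (contDiff_prod fun r _ => h r)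

theorem contDiffAt_wachspress (T : ConvexPolygon n) (i : Fin n) {x : Plane}
    (hx : ∑ j, T.weight j x ≠ 0) : ContDiffAt ℝ 1 (T.wachspress i) x :=
  (T.contDiff_weight i).contDiffAt.div
    (ContDiff.sum fun j _ => T.contDiff_weight j).contDiffAt hx

theorem contDiffAt_wachspressMap (ref T : ConvexPolygon n) {x : Plane}
    (hx : ∑ j, ref.weight j x ≠ 0) : ContDiffAt ℝ 1 (wachspressMap ref T) x :=
  ContDiffAt.sum fun i _ => (ref.contDiffAt_wachspress i hx).smul contDiffAt_const

theorem fderiv_wachspress (T : ConvexPolygon n) (i : Fin n) {x : Plane}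
    (hx : ∑ j, T.weight j x ≠ 0) (v : Plane) :
    fderiv ℝ (T.wachspress i) x v =
      (T.weightDeriv i x v - T.wachspress i x * ∑ j, T.weightDeriv j x v) /
        ∑ j, T.weight j x := by
  have hW : HasFDerivAt (fun y => ∑ j, T.weight j y) (∑ j, T.weightDeriv j x) x :=
    HasFDerivAt.fun_sum fun j _ => T.hasFDerivAt_weight j x
  have hl := ((T.contDiffAt_wachspress i hx).differentiableAt one_ne_zero).hasFDerivAt
  have hprod := hl.mul hW
  -- The quotient rule comes from differentiating λ_i ∑ w_j = w_i and comparing the two derivatives.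
  have hev : T.weight i =ᶠ[nhds x] fun y => T.wachspress i y * ∑ j, T.weight j y := by
    filter_upwards [hW.continuousAt.eventually_ne hx] with y hy
    rw [wachspress, div_mul_cancel₀ _ hy]
  have heq := (T.hasFDerivAt_weight i x).unique (hprod.congr_of_eventuallyEq hev)
  have := congrArg (fun L : Plane →L[ℝ] ℝ => L v) heq
  simp only [_root_.add_apply, _root_.smul_apply, smul_eq_mul,
    _root_.sum_apply] at this
  rw [this]
  field_simp
  ring

theorem sum_wachspress (T : ConvexPolygon n) {x : Plane} (hx : ∑ j, T.weight j x ≠ 0) :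
    ∑ i, T.wachspress i x = 1 := by
  simp only [wachspress, ← Finset.sum_div, div_self hx]

theorem sum_fderiv_wachspress (T : ConvexPolygon n) {x : Plane}
    (hx : ∑ j, T.weight j x ≠ 0) (v : Plane) : ∑ i, fderiv ℝ (T.wachspress i) x v = 0 := by
  simp only [T.fderiv_wachspress _ hx, ← Finset.sum_div, Finset.sum_sub_distrib,
    ← Finset.sum_mul, T.sum_wachspress hx, one_mul, sub_self, zero_div]

theorem fderiv_wachspressMap (ref T : ConvexPolygon n) {x : Plane}
    (hx : ∑ j, ref.weight j x ≠ 0) (v : Plane) :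
    fderiv ℝ (wachspressMap ref T) x v = ∑ i, fderiv ℝ (ref.wachspress i) x v • T.a i := by
  have h : HasFDerivAt (wachspressMap ref T)
      (∑ i, (fderiv ℝ (ref.wachspress i) x).smulRight (T.a i)) x :=
    HasFDerivAt.fun_sum fun i _ =>
      ((ref.contDiffAt_wachspress i hx).differentiableAt one_ne_zero).hasFDerivAt.smul_const _
  rw [h.fderiv]
  simp

end ConvexPolygon

/-! ### The Jacobian determinant -/

theorem det_jacobianMatrix (F : Plane → Plane) (x : Plane) :
    (jacobianMatrix F x).det = cross (fderiv ℝ F x (EuclideanSpace.single 0 1))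
      (fderiv ℝ F x (EuclideanSpace.single 1 1)) := by
  simp only [Matrix.det_fin_two, jacobianMatrix, Matrix.of_apply, cross]
  ring

namespace ConvexPolygon

variable {n : ℕ} [NeZero n]

theorem continuousAt_det_jacobianMatrix (ref T : ConvexPolygon n) {x : Plane}
    (hx : ∑ j, ref.weight j x ≠ 0) :
    ContinuousAt (fun y => (jacobianMatrix (wachspressMap ref T) y).det) x := by
  have h := (contDiffAt_wachspressMap ref T hx).continuousAt_fderiv one_ne_zero
  simp only [det_jacobianMatrix, cross]
  have hv : ∀ (v : Plane) (s : Fin 2),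
      ContinuousAt (fun y => fderiv ℝ (wachspressMap ref T) y v s) x := by
    intro v s
    have h1 : ContinuousAt (fun y => fderiv ℝ (wachspressMap ref T) y v) x :=
      h.clm_apply continuousAt_const
    exact (EuclideanSpace.proj (𝕜 := ℝ) s).continuous.continuousAt.comp h1
  exact ((hv _ _).mul (hv _ _)).sub ((hv _ _).mul (hv _ _))

/-- The sum of the two dual vertices belonging to the edges at the vertex `a i`. -/
noncomputable def dualMidpoint (T : ConvexPolygon n) (x : Plane) (i : Fin n) : Plane :=
  (T.edgeDist (i - 1) x)⁻¹ • T.normal (i - 1) + (T.edgeDist i x)⁻¹ • T.normal i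

/-- The gradient of h_r is -n_r, so the logarithmic derivative of w_i is minus the sum over the far
edges. Completing this to the sum over all edges isolates a term independent of `i`. -/
theorem weightDeriv_apply (T : ConvexPolygon n) (i : Fin n) {x : Plane}
    (hx : ∀ r, 0 < T.edgeDist r x) (v : Plane) :
    T.weightDeriv i x v = T.weight i x *
      (inner ℝ (T.dualMidpoint x i) v - ∑ r, (T.edgeDist r x)⁻¹ * inner ℝ (T.normal r) v) := by
  have hsplit : ∑ r, (T.edgeDist r x)⁻¹ * inner ℝ (T.normal r) v =
      inner ℝ (T.dualMidpoint x i) v +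
        ∑ r ∈ farEdges i, (T.edgeDist r x)⁻¹ * inner ℝ (T.normal r) v := by
    rw [← Finset.sum_filter_not_add_sum_filter _ (fun j : Fin n => j ≠ i - 1 ∧ j ≠ i)]
    congr 1
    have : Finset.univ.filter (fun j : Fin n => ¬(j ≠ i - 1 ∧ j ≠ i)) = {i - 1, i} := by
      ext j
      simp only [Finset.mem_filter, Finset.mem_univ, true_and, Finset.mem_insert,
        Finset.mem_singleton]
      tauto
    rw [this, Finset.sum_pair (T.sub_one_ne i), dualMidpoint, inner_add_left,
      real_inner_smul_left, real_inner_smul_left]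
  rw [hsplit, weightDeriv, weight, sub_add_cancel_left, _root_.smul_apply,
    _root_.sum_apply, smul_eq_mul, mul_assoc, mul_neg]
  congr 1
  rw [Finset.mul_sum, ← Finset.sum_neg_distrib]
  refine Finset.sum_congr rfl fun r hr => ?_
  rw [_root_.smul_apply, _root_.neg_apply, innerSL_apply_apply,
    smul_eq_mul, ← Finset.mul_prod_erase (farEdges i) (fun j => T.edgeDist j x) hr]
  have := (hx r).ne'
  field_simp

/-- The determinant of the Jacobian matrix as a sum over triples of vertices. -/
theorem six_mul_det_jacobianMatrix (ref T : ConvexPolygon n) {x : Plane}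
    (hx : ∀ r, 0 < ref.edgeDist r x) (hW : ∑ j, ref.weight j x ≠ 0) :
    6 * (jacobianMatrix (wachspressMap ref T) x).det =
      ∑ i, ∑ j, ∑ k, ref.wachspress i x * ref.wachspress j x * ref.wachspress k x *
        (triArea (ref.dualMidpoint x i) (ref.dualMidpoint x j) (ref.dualMidpoint x k) *
          triArea (T.a i) (T.a j) (T.a k)) := by
  rw [det_jacobianMatrix, fderiv_wachspressMap ref T hW, fderiv_wachspressMap ref T hW]
  have hcoord : ∀ (u : Plane) (s : Fin 2), inner ℝ u (EuclideanSpace.single s (1 : ℝ)) = u s := by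
    intro u s
    simp [EuclideanSpace.inner_single_right]
  -- Normalization subtracts the λ-weighted mean of the logarithmic gradients, and the sum common to
  -- all `i` cancels.
  have hlog : ∀ (s : Fin 2) (i : Fin n),
      fderiv ℝ (ref.wachspress i) x (EuclideanSpace.single s 1) = ref.wachspress i x *
        (ref.dualMidpoint x i s - (∑ j, ref.wachspress j x • ref.dualMidpoint x j) s) := by
    intro s i
    rw [ref.fderiv_wachspress i hW]
    simp only [ref.weightDeriv_apply _ hx, hcoord, WithLp.ofLp_sum, Finset.sum_apply,
      PiLp.smul_apply, smul_eq_mul]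
    have h1 : ∀ j, ref.weight j x = ref.wachspress j x * ∑ k, ref.weight k x := by
      intro j; rw [wachspress, div_mul_cancel₀ _ hW]
    have h2 := ref.sum_wachspress hW
    have h3 : ∀ S : ℝ, ∑ j, ref.weight j x * (ref.dualMidpoint x j s - S) =
        (∑ j, ref.wachspress j x * ref.dualMidpoint x j s - S) * ∑ k, ref.weight k x := by
      intro S
      calc _ = ∑ j, (ref.wachspress j x * ref.dualMidpoint x j s * ∑ k, ref.weight k x -
            ref.wachspress j x * (S * ∑ k, ref.weight k x)) :=
            Finset.sum_congr rfl fun j _ => by rw [h1 j]; ring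
        _ = _ := by
          rw [Finset.sum_sub_distrib, ← Finset.sum_mul, ← Finset.sum_mul, h2]; ring
    rw [h3, h1 i, div_eq_iff hW]
    ring
  exact cross_sum_eq_sum_triArea _ _ _ _ (ref.dualMidpoint x) _ (ref.sum_wachspress hW)
    (ref.sum_fderiv_wachspress hW _) (ref.sum_fderiv_wachspress hW _) (hlog 0) (hlog 1)

end ConvexPolygon

/-! ### Quantitative bounds for fixed `n` -/

/-- `E` is the product of three edge distances, which may be arbitrarily small. It enters the
weights as a factor and the dual area as a divisor, so it leaves no trace in the result; 12 is 6
times the 2 from the midpoint estimate. -/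
theorem le_of_product_bounds {b E ν κ η N q A L J : ℝ} (hE : 0 < E) (hb : 0 ≤ b) (hν : 0 < ν)
    (hL : b ^ 3 * E / ν ^ 3 ≤ L) (hN : κ ^ 2 ≤ N) (hq : N / E / 2 ≤ q) (hA : η ^ 2 ≤ A)
    (hJ : L * (q * A) ≤ 6 * J) : b ^ 3 * κ ^ 2 / (12 * ν ^ 3) * η ^ 2 ≤ J := by
  have hq' : κ ^ 2 / E / 2 ≤ q := le_trans (by gcongr) hq
  have hq0 : 0 ≤ κ ^ 2 / E / 2 := by positivity
  have hL0 : 0 ≤ b ^ 3 * E / ν ^ 3 := by positivity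
  have h := mul_le_mul hL (mul_le_mul hq' hA (sq_nonneg η) (hq0.trans hq'))
    (mul_nonneg hq0 (sq_nonneg η)) (hL0.trans hL)
  have hsimp : b ^ 3 * E / ν ^ 3 * (κ ^ 2 / E / 2 * η ^ 2) =
      6 * (b ^ 3 * κ ^ 2 / (12 * ν ^ 3) * η ^ 2) := by
    field_simp
    ring
  linarith

namespace ConvexPolygon

variable {n : ℕ} [NeZero n]

theorem weight_nonneg (T : ConvexPolygon n) (i : Fin n) {x : Plane} (hx : x ∈ T.carrier) :
    0 ≤ T.weight i x :=
  mul_nonneg (T.cross_normal_pos i).le (Finset.prod_nonneg fun r _ => T.edgeDist_nonneg r hx)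

theorem prod_edgeDist_le_one (T : ConvexPolygon n) (hd : T.diam ≤ 1) (S : Finset (Fin n))
    {x : Plane} (hx : x ∈ T.carrier) : ∏ r ∈ S, T.edgeDist r x ≤ 1 :=
  Finset.prod_le_one (fun r _ => T.edgeDist_nonneg r hx)
    fun r _ => (T.edgeDist_le_diam r hx).trans hd

theorem weight_le_one (T : ConvexPolygon n) (hd : T.diam ≤ 1) (i : Fin n) {x : Plane}
    (hx : x ∈ T.carrier) : T.weight i x ≤ 1 :=
  mul_le_one₀ (T.cross_normal_le_one _ _)
    (Finset.prod_nonneg fun r _ => T.edgeDist_nonneg r hx) (T.prod_edgeDist_le_one hd _ hx)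

theorem sum_weight_le (T : ConvexPolygon n) (hd : T.diam ≤ 1) {x : Plane} (hx : x ∈ T.carrier) :
    ∑ i, T.weight i x ≤ n := by
  calc ∑ i, T.weight i x ≤ ∑ _i : Fin n, (1 : ℝ) :=
        Finset.sum_le_sum fun i _ => T.weight_le_one hd i hx
    _ = n := by simp

theorem abs_weightDeriv_le (T : ConvexPolygon n) (hd : T.diam ≤ 1) (i : Fin n) {x : Plane}
    (hx : x ∈ T.carrier) (v : Plane) : |T.weightDeriv i x v| ≤ n * ‖v‖ := by
  have hc := T.cross_normal_pos i
  have hterm : ∀ r, |((∏ j ∈ (farEdges i).erase r, T.edgeDist j x) •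
      -innerSL ℝ (T.normal r)) v| ≤ ‖v‖ := by
    intro r
    rw [_root_.smul_apply, smul_eq_mul, abs_mul,
      abs_of_nonneg (Finset.prod_nonneg fun r _ => T.edgeDist_nonneg r hx)]
    refine (mul_le_of_le_one_left (abs_nonneg _) (T.prod_edgeDist_le_one hd _ hx)).trans ?_
    rw [_root_.neg_apply, abs_neg, innerSL_apply_apply]
    simpa [T.norm_normal] using abs_real_inner_le_norm (T.normal r) v
  rw [weightDeriv, _root_.smul_apply, _root_.sum_apply, smul_eq_mul, abs_mul, abs_of_pos hc]
  refine (mul_le_of_le_one_left (abs_nonneg _) (T.cross_normal_le_one _ _)).trans ?_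
  refine (Finset.abs_sum_le_sum_abs _ _).trans ?_
  refine (Finset.sum_le_card_nsmul _ _ _ fun r _ => hterm r).trans ?_
  rw [nsmul_eq_mul]
  gcongr
  simpa using Finset.card_le_univ (farEdges i)

/-- `κ` bounds the distances of the vertices from the lines of the far edges from below. -/
def FarEdgeBound (T : ConvexPolygon n) (κ : ℝ) : Prop :=
  ∀ i j : Fin n, j ≠ i - 1 → j ≠ i → κ ≤ T.edgeDist j (T.a i)

/-- The next edge line passes through `a (i + 1)` and is far from `a i`. -/
theorem FarEdgeBound.le_norm_edge {T : ConvexPolygon n} {κ : ℝ} (hT : T.FarEdgeBound κ)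
    (i : Fin n) : κ ≤ ‖T.a (i + 1) - T.a i‖ := by
  have h1 := hT i (i + 1) (T.add_one_ne_sub_one i) (T.add_one_ne i)
  refine h1.trans ?_
  rw [← dist_eq_norm]
  exact T.edgeDist_le_dist _ _ _ (T.edgeDist_self _)

theorem FarEdgeBound.le_cross_normal {T : ConvexPolygon n} {κ : ℝ} (hT : T.FarEdgeBound κ)
    (hd : T.diam ≤ 1) (i : Fin n) : κ ≤ cross (T.normal (i - 1)) (T.normal i) := by
  have h1 := hT (i - 1) i (T.sub_one_ne i ∘ fun h => ?_) (T.sub_one_ne i).symm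
  · rw [edgeDist_eq_norm_mul_cross] at h1
    refine h1.trans (mul_le_of_le_one_left (T.cross_normal_pos i).le ?_)
    rw [← dist_eq_norm]
    exact (T.dist_le_diam (T.vertex_mem_carrier _) (T.vertex_mem_carrier _)).trans hd
  · have := T.add_one_ne_sub_one (i - 1)
    rw [sub_add_one] at this
    exact absurd h this

theorem FarEdgeBound.sq_le_triArea {T : ConvexPolygon n} {κ : ℝ} (hT : T.FarEdgeBound κ)
    (hκ : 0 ≤ κ) (i : Fin n) : κ ^ 2 ≤ triArea (T.a (i - 1)) (T.a i) (T.a (i + 1)) := by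
  rw [triArea_rotate, triArea]
  have h2 := T.edgeDist_eq_cross i (T.a (i - 1))
  have h3 := T.edge_norm_pos i
  have h4 : cross (T.a (i + 1) - T.a i) (T.a (i - 1) - T.a i) =
      ‖T.a (i + 1) - T.a i‖ * T.edgeDist i (T.a (i - 1)) := by
    rw [h2, mul_inv_cancel_left₀ h3.ne']
  rw [h4, sq]
  refine mul_le_mul (hT.le_norm_edge i) (hT (i - 1) i ?_ (T.sub_one_ne i).symm) hκ h3.le
  have := T.add_one_ne_sub_one (i - 1)
  rwa [sub_add_one] at this

theorem FarEdgeBound.le_one {ref : ConvexPolygon n} {κ : ℝ} (href : ref.FarEdgeBound κ) (hd : ref.diam ≤ 1) : κ ≤ 1 :=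
  (href.le_cross_normal hd 0).trans (ref.cross_normal_le_one _ _)

theorem le_prod_edgeDist {ref : ConvexPolygon n} {x : Plane} {m : Fin n} {δ : ℝ} (hδ : 0 ≤ δ) (hδ1 : δ ≤ 1)
    (hm : ∀ r, r ≠ m - 1 → r ≠ m → δ ≤ ref.edgeDist r x)
    {S : Finset (Fin n)} (h1 : m - 1 ∉ S) (h2 : m ∉ S) :
    δ ^ n ≤ ∏ r ∈ S, ref.edgeDist r x := by
  calc δ ^ n ≤ δ ^ S.card :=
        pow_le_pow_of_le_one hδ hδ1 (by simpa using Finset.card_le_univ S)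
    _ = ∏ _r ∈ S, δ := by simp
    _ ≤ _ := Finset.prod_le_prod (fun _ _ => hδ) fun r hr =>
      hm r (by rintro rfl; exact h1 hr) (by rintro rfl; exact h2 hr)

theorem le_weight {ref : ConvexPolygon n} {κ : ℝ} (hκ : 0 < κ)
    (href : ref.FarEdgeBound κ) (hd : ref.diam ≤ 1) {x : Plane}
    {m : Fin n} {δ : ℝ} (hδ : 0 ≤ δ) (hδ1 : δ ≤ 1)
    (hm : ∀ r, r ≠ m - 1 → r ≠ m → δ ≤ ref.edgeDist r x) : κ * δ ^ n ≤ ref.weight m x :=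
  mul_le_mul (href.le_cross_normal hd m)
    (le_prod_edgeDist hδ hδ1 hm (by simp) (by simp)) (by positivity)
    (hκ.le.trans (href.le_cross_normal hd m))

/-- One factor, the only one allowed to be small, is kept explicit; the others stay away from the
two edges at `m`. -/
theorem mul_edgeDist_le_weight {ref : ConvexPolygon n} {κ : ℝ} (hκ : 0 < κ)
    (href : ref.FarEdgeBound κ) (hd : ref.diam ≤ 1) {x : Plane} (hx : x ∈ ref.carrier)
    {m i t : Fin n} {δ : ℝ} (hδ : 0 ≤ δ) (hδ1 : δ ≤ 1)
    (hm : ∀ r, r ≠ m - 1 → r ≠ m → δ ≤ ref.edgeDist r x) (ht : t ∈ farEdges i)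
    (h1 : m - 1 ∉ (farEdges i).erase t) (h2 : m ∉ (farEdges i).erase t) :
    κ * δ ^ n * ref.edgeDist t x ≤ ref.weight i x := by
  rw [weight, ← Finset.mul_prod_erase (farEdges i) (fun j => ref.edgeDist j x) ht]
  have h3 := le_prod_edgeDist hδ hδ1 hm h1 h2
  have h4 := href.le_cross_normal hd i
  have h5 := ref.edgeDist_nonneg t hx
  calc κ * δ ^ n * ref.edgeDist t x ≤ cross (ref.normal (i - 1)) (ref.normal i) *
        (∏ j ∈ (farEdges i).erase t, ref.edgeDist j x) * ref.edgeDist t x := by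
          have := hκ.le.trans h4
          gcongr
    _ = _ := by ring

theorem le_sum_weight {ref : ConvexPolygon n} {κ : ℝ} (hκ : 0 < κ)
    (href : ref.FarEdgeBound κ) (hd : ref.diam ≤ 1) {x : Plane} (hx : x ∈ ref.carrier)
    : κ * (κ / n) ^ n ≤ ∑ i, ref.weight i x := by
  have hn : (1 : ℝ) ≤ n := by exact_mod_cast NeZero.pos n
  obtain ⟨m, hm⟩ := ref.exists_vertex_edgeDist_ge href hx
  have h1 : κ / n ≤ 1 := (div_le_self hκ.le hn).trans (href.le_one hd)
  exact (le_weight hκ href hd (by positivity) h1 hm).trans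
    (Finset.single_le_sum (fun i _ => ref.weight_nonneg i hx) (Finset.mem_univ m))

theorem sum_weight_pos {ref : ConvexPolygon n} {κ : ℝ} (hκ : 0 < κ)
    (href : ref.FarEdgeBound κ) (hd : ref.diam ≤ 1) {x : Plane} (hx : x ∈ ref.carrier)
    : 0 < ∑ i, ref.weight i x := by
  have hn : (0 : ℝ) < n := by exact_mod_cast NeZero.pos n
  exact lt_of_lt_of_le (by positivity) (le_sum_weight hκ href hd hx)

theorem abs_fderiv_wachspress_le {ref : ConvexPolygon n} {κ : ℝ} (hκ : 0 < κ)
    (href : ref.FarEdgeBound κ) (hd : ref.diam ≤ 1) {x : Plane} (hx : x ∈ ref.carrier)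
    (i : Fin n) (v : Plane) :
    |fderiv ℝ (ref.wachspress i) x v| ≤ (n + n ^ 2) / (κ * (κ / n) ^ n) * ‖v‖ := by
  have hn : (0 : ℝ) < n := by exact_mod_cast NeZero.pos n
  have hW := sum_weight_pos hκ href hd hx
  have hW' := le_sum_weight hκ href hd hx
  rw [ref.fderiv_wachspress i hW.ne', abs_div, abs_of_pos hW, div_mul_eq_mul_div]
  have h1 := ref.abs_weightDeriv_le hd i hx v
  have h2 : |∑ j, ref.weightDeriv j x v| ≤ n * (n * ‖v‖) := by
    refine (Finset.abs_sum_le_sum_abs _ _).trans ?_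
    refine (Finset.sum_le_card_nsmul _ _ _ fun j _ => ref.abs_weightDeriv_le hd j hx v).trans ?_
    simp
  have h3 : |ref.wachspress i x| ≤ 1 := by
    rw [wachspress, abs_of_nonneg (div_nonneg (ref.weight_nonneg i hx) hW.le), div_le_one hW]
    exact Finset.single_le_sum (fun i _ => ref.weight_nonneg i hx) (Finset.mem_univ i)
  have h4 : |ref.weightDeriv i x v - ref.wachspress i x * ∑ j, ref.weightDeriv j x v| ≤
      (n + n ^ 2) * ‖v‖ := by
    refine (abs_sub _ _).trans ?_
    rw [abs_mul]
    nlinarith [mul_le_mul h3 h2 (abs_nonneg _) zero_le_one]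
  gcongr

theorem det_jacobianMatrix_le {ref : ConvexPolygon n} {κ : ℝ} (hκ : 0 < κ)
    (href : ref.FarEdgeBound κ) (hd : ref.diam ≤ 1) {x : Plane} (hx : x ∈ ref.carrier)
    (T : ConvexPolygon n) :
    (jacobianMatrix (wachspressMap ref T) x).det ≤
      (n * ((n + n ^ 2) / (κ * (κ / n) ^ n))) ^ 2 * T.diam ^ 2 := by
  have hW := sum_weight_pos hκ href hd hx
  set B : ℝ := (n + n ^ 2) / (κ * (κ / n) ^ n) with hB
  have key : ∀ s : Fin 2, ‖fderiv ℝ (wachspressMap ref T) x (EuclideanSpace.single s 1)‖ ≤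
      n * B * T.diam := by
    intro s
    set v : Plane := EuclideanSpace.single s 1
    have hv : ‖v‖ = 1 := by simp [v]
    -- The derivatives of the coordinates sum to zero, so `a 0` may be subtracted and only vertex
    -- differences, bounded by the diameter, remain.
    have h1 : fderiv ℝ (wachspressMap ref T) x v =
        ∑ i, fderiv ℝ (ref.wachspress i) x v • (T.a i - T.a 0) := by
      rw [fderiv_wachspressMap ref T hW.ne']
      simp only [smul_sub, Finset.sum_sub_distrib, ← Finset.sum_smul,
        ref.sum_fderiv_wachspress hW.ne', zero_smul, sub_zero]
    have hterm : ∀ i, ‖fderiv ℝ (ref.wachspress i) x v • (T.a i - T.a 0)‖ ≤ B * T.diam := by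
      intro i
      have h2 := abs_fderiv_wachspress_le hκ href hd hx i v
      rw [hv, mul_one] at h2
      rw [norm_smul, Real.norm_eq_abs, ← dist_eq_norm]
      have h3 := T.dist_le_diam (T.vertex_mem_carrier i) (T.vertex_mem_carrier 0)
      exact mul_le_mul h2 h3 dist_nonneg ((abs_nonneg _).trans h2)
    rw [h1]
    refine (norm_sum_le_of_le _ fun i _ => hterm i).trans ?_
    simp [mul_assoc]
  rw [det_jacobianMatrix]
  refine (le_abs_self _).trans ((abs_cross_le _ _).trans ?_)
  refine (mul_le_mul (key 0) (key 1) (norm_nonneg _) ((norm_nonneg _).trans (key 0))).trans ?_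
  apply le_of_eq; ring

theorem le_det_jacobianMatrix_interior {ref : ConvexPolygon n} {κ : ℝ} (hκ : 0 < κ)
    (href : ref.FarEdgeBound κ) (hd : ref.diam ≤ 1) {x : Plane} (hx : x ∈ ref.carrier)
    (hpos : ∀ r, 0 < ref.edgeDist r x) {T : ConvexPolygon n}
    {η : ℝ} (hη : 0 ≤ η) (hT : T.FarEdgeBound η) :
    (κ * (κ / n) ^ n) ^ 3 * κ ^ 2 / (12 * n ^ 3) * η ^ 2 ≤
      (jacobianMatrix (wachspressMap ref T) x).det := by
  have hn : (1 : ℝ) ≤ n := by exact_mod_cast NeZero.pos n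
  have hW := sum_weight_pos hκ href hd hx
  have hWn := ref.sum_weight_le hd hx
  obtain ⟨m, hm⟩ := ref.exists_vertex_edgeDist_ge href hx
  have hδ : 0 ≤ κ / n := by positivity
  have hδ1 : κ / n ≤ 1 := (div_le_self hκ.le hn).trans (href.le_one hd)
  have hl : ∀ i, 0 ≤ ref.wachspress i x := fun i => div_nonneg (ref.weight_nonneg i hx) hW.le
  have hq : ∀ i j k, i < j → j < k →
      0 ≤ triArea (ref.dualMidpoint x i) (ref.dualMidpoint x j) (ref.dualMidpoint x k) :=
    fun i j k h h' => (ref.polarDual x hpos).triArea_midpoints_nonneg h h'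
  have hterm : ∀ i j k, 0 ≤ ref.wachspress i x * ref.wachspress j x * ref.wachspress k x *
      (triArea (ref.dualMidpoint x i) (ref.dualMidpoint x j) (ref.dualMidpoint x k) *
        triArea (T.a i) (T.a j) (T.a k)) := fun i j k =>
    mul_nonneg (mul_nonneg (mul_nonneg (hl i) (hl j)) (hl k))
      (triArea_mul_triArea_nonneg hq (fun _ _ _ h h' => (T.triArea_pos h h').le) i j k)
  have hsix := six_mul_det_jacobianMatrix ref T hpos hW.ne'
  -- All terms being nonnegative, the sum dominates the one with indices `m - 1`, `m`, `m + 1`.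
  have hsingle : ref.wachspress (m - 1) x * ref.wachspress m x * ref.wachspress (m + 1) x *
      (triArea (ref.dualMidpoint x (m - 1)) (ref.dualMidpoint x m) (ref.dualMidpoint x (m + 1)) *
        triArea (T.a (m - 1)) (T.a m) (T.a (m + 1))) ≤
      6 * (jacobianMatrix (wachspressMap ref T) x).det := by
    rw [hsix]
    refine le_trans ?_ (Finset.single_le_sum (fun i _ => Finset.sum_nonneg fun j _ =>
      Finset.sum_nonneg fun k _ => hterm i j k) (Finset.mem_univ (m - 1)))
    refine le_trans ?_ (Finset.single_le_sum (fun j _ =>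
      Finset.sum_nonneg fun k _ => hterm _ j k) (Finset.mem_univ m))
    exact Finset.single_le_sum (f := fun k => ref.wachspress (m - 1) x * ref.wachspress m x *
      ref.wachspress k x * (triArea (ref.dualMidpoint x (m - 1)) (ref.dualMidpoint x m)
        (ref.dualMidpoint x k) * triArea (T.a (m - 1)) (T.a m) (T.a k)))
      (fun k _ => hterm _ _ k) (Finset.mem_univ (m + 1))
  have hA := hT.sq_le_triArea hη m
  have hdual : ref.lineDet (m - 1) m (m + 1) x /
      (ref.edgeDist (m - 1) x * ref.edgeDist m x * ref.edgeDist (m + 1) x) / 2 ≤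
      triArea (ref.dualMidpoint x (m - 1)) (ref.dualMidpoint x m)
        (ref.dualMidpoint x (m + 1)) := by
    rw [← ref.triArea_inv_smul_normal hpos]
    exact (ref.polarDual x hpos).triArea_consecutive_midpoints m
  have hN : κ ^ 2 ≤ ref.lineDet (m - 1) m (m + 1) x := by
    rw [lineDet_consecutive, sq]
    have h1 := href m (m + 1) (ref.add_one_ne_sub_one m) (ref.add_one_ne m)
    exact mul_le_mul h1 (href.le_cross_normal hd m) hκ.le (hκ.le.trans h1)
  have e1 : m - 1 ≠ m := ref.sub_one_ne m
  have e2 : m + 1 ≠ m - 1 := ref.add_one_ne_sub_one m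
  have e3 : m + 1 ≠ m := ref.add_one_ne m
  have e4 : m ≠ m - 1 - 1 := by
    have := ref.add_one_ne_sub_one (m - 1)
    rwa [sub_add_one] at this
  have e5 : m + 1 - 1 = m := add_sub_one m
  -- The factors extracted from the three weights are chosen so that their product is exactly the
  -- denominator in `hdual`. The one taken from the weight of `m` need not be small.
  have w1 : κ * (κ / n) ^ n * ref.edgeDist m x ≤ ref.weight (m - 1) x :=
    mul_edgeDist_le_weight hκ href hd hx hδ hδ1 hm (by simp [e4, e1.symm]) (by simp) (by simp)
  have w2 : κ * (κ / n) ^ n * ref.edgeDist (m + 1) x ≤ ref.weight m x :=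
    mul_edgeDist_le_weight hκ href hd hx hδ hδ1 hm (by simp [e2, e3]) (by simp) (by simp)
  have w3 : κ * (κ / n) ^ n * ref.edgeDist (m - 1) x ≤ ref.weight (m + 1) x :=
    mul_edgeDist_le_weight hκ href hd hx hδ hδ1 hm (by simp [e5, e1, e2.symm]) (by simp)
      (by simp [e5])
  set b : ℝ := κ * (κ / n) ^ n with hb
  have hb0 : 0 < b := by positivity
  have hfac : ∀ i t, b * ref.edgeDist t x ≤ ref.weight i x →
      0 ≤ b * ref.edgeDist t x / n ∧ b * ref.edgeDist t x / n ≤ ref.wachspress i x := by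
    intro i t h
    have := hpos t
    exact ⟨by positivity, div_le_div₀ (ref.weight_nonneg i hx) h hW hWn⟩
  obtain ⟨a1, b1⟩ := hfac _ _ w1
  obtain ⟨a2, b2⟩ := hfac _ _ w2
  obtain ⟨a3, b3⟩ := hfac _ _ w3
  have hlll : b ^ 3 * (ref.edgeDist (m - 1) x * ref.edgeDist m x * ref.edgeDist (m + 1) x) / n ^ 3 ≤
      ref.wachspress (m - 1) x * ref.wachspress m x * ref.wachspress (m + 1) x := by
    refine le_trans (le_of_eq ?_)
      (mul_le_mul (mul_le_mul b1 b2 a2 (hl _)) b3 a3 (mul_nonneg (hl _) (hl _)))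
    ring
  have hE : 0 < ref.edgeDist (m - 1) x * ref.edgeDist m x * ref.edgeDist (m + 1) x :=
    mul_pos (mul_pos (hpos _) (hpos _)) (hpos _)
  exact le_of_product_bounds hE hb0.le (by linarith) hlll hN hdual hA hsingle

/-- The polar dual exists only at interior points; the bound does not depend on the point and passes
to the boundary by continuity of the determinant. -/
theorem le_det_jacobianMatrix {ref : ConvexPolygon n} {κ : ℝ} (hκ : 0 < κ)
    (href : ref.FarEdgeBound κ) (hd : ref.diam ≤ 1) {x : Plane} (hx : x ∈ ref.carrier)
    {T : ConvexPolygon n} {η : ℝ} (hη : 0 ≤ η)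
    (hT : T.FarEdgeBound η) :
    (κ * (κ / n) ^ n) ^ 3 * κ ^ 2 / (12 * n ^ 3) * η ^ 2 ≤
      (jacobianMatrix (wachspressMap ref T) x).det := by
  have hcont := continuousAt_det_jacobianMatrix ref T (sum_weight_pos hκ href hd hx).ne'
  have hcl := mem_closure_iff_nhdsWithin_neBot.1 (ref.mem_closure_interior_points hx)
  refine ge_of_tendsto (hcont.tendsto.mono_left
    (nhdsWithin_le_nhds (s := {y ∈ ref.carrier | ∀ r, 0 < ref.edgeDist r y}))) ?_
  filter_upwards [self_mem_nhdsWithin] with y hy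
  exact le_det_jacobianMatrix_interior hκ href hd hy.1 hy.2 hη hT

/-! ### Uniformity in the polygons and in `n` -/

theorem diam_pos (T : ConvexPolygon n) : 0 < T.diam := by
  refine lt_of_lt_of_le (T.edge_norm_pos 0) ?_
  rw [← dist_eq_norm]
  exact T.dist_le_diam (T.vertex_mem_carrier _) (T.vertex_mem_carrier _)

theorem farEdgeBound_minEdgeDist (T : ConvexPolygon n) : T.FarEdgeBound T.minEdgeDist := by
  intro i j h h'
  exact (ciInf_le (Set.finite_range _).bddBelow i).trans
    (ciInf_le (Set.finite_range fun j : {j : Fin n // j ≠ i - 1 ∧ j ≠ i} =>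
      T.edgeDist j (T.a i)).bddBelow ⟨j, h, h'⟩)

theorem FarEdgeBound.mono {T : ConvexPolygon n} {κ η : ℝ} (hT : T.FarEdgeBound η) (h : κ ≤ η) :
    T.FarEdgeBound κ := fun i j h1 h2 => h.trans (hT i j h1 h2)

theorem FarEdgeBound.le_dist {T : ConvexPolygon n} {κ : ℝ} (hT : T.FarEdgeBound κ) {i j : Fin n}
    (hij : i ≠ j) : κ ≤ dist (T.a i) (T.a j) := by
  by_cases h : i = j + 1
  · subst h
    rw [dist_eq_norm]
    exact hT.le_norm_edge j
  · have h1 : j ≠ i - 1 := by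
      rintro rfl
      exact h (sub_add_one i).symm
    rw [dist_comm]
    exact (hT i j h1 hij.symm).trans (T.edgeDist_le_dist _ _ _ (T.edgeDist_self j))

/-- The number of vertices is bounded in terms of the relative distance of the vertices from
the far edges. -/
theorem exists_card_bound {C : ℝ} (hC : 0 < C) :
    ∃ N : ℕ, ∀ (n : ℕ) [NeZero n] (T : ConvexPolygon n), T.FarEdgeBound (C * T.diam) → n ≤ N := by
  have htb : TotallyBounded (Metric.closedBall (0 : Plane) 1) :=
    (isCompact_closedBall 0 1).totallyBounded
  -- Rescaled to diameter 1, the vertices are at mutual distance at least `C`, so no ball of radius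
  -- C/2 contains two of them and the size of the cover bounds `n`.
  obtain ⟨t, ht, hcover⟩ := Metric.totallyBounded_iff.1 htb (C / 2) (by positivity)
  refine ⟨ht.toFinset.card, fun n _ T hT => ?_⟩
  have hd := T.diam_pos
  have hnorm : ∀ i, T.diam⁻¹ • (T.a i - T.a 0) ∈ Metric.closedBall (0 : Plane) 1 := by
    intro i
    rw [mem_closedBall_zero_iff, norm_smul, ← dist_eq_norm, norm_inv, Real.norm_eq_abs,
      abs_of_pos hd, inv_mul_le_iff₀ hd, mul_one]
    exact T.dist_le_diam (T.vertex_mem_carrier i) (T.vertex_mem_carrier 0)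
  have hex : ∀ i, ∃ y ∈ t, dist (T.diam⁻¹ • (T.a i - T.a 0)) y < C / 2 := by
    intro i
    simpa using hcover (hnorm i)
  choose y hyt hy using hex
  have hinj : Function.Injective y := by
    intro i j hij
    by_contra hne
    have h1 := hT.le_dist hne
    have h2 : dist (T.diam⁻¹ • (T.a i - T.a 0)) (T.diam⁻¹ • (T.a j - T.a 0)) < C := by
      have h3 := hy i
      have h4 := hy j
      rw [← hij, dist_comm] at h4
      linarith [dist_triangle (T.diam⁻¹ • (T.a i - T.a 0)) (y i) (T.diam⁻¹ • (T.a j - T.a 0))]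
    rw [dist_smul₀, dist_sub_right, norm_inv, Real.norm_eq_abs, abs_of_pos hd,
      inv_mul_lt_iff₀ hd, mul_comm] at h2
    linarith
  have := Finset.card_le_card_of_injOn (s := Finset.univ) (t := ht.toFinset) y
    (fun i _ => by simpa using hyt i) hinj.injOn
  simpa using this

/-- Regular `n`-gons of diameter one have vertices uniformly far from the far edges. -/
theorem exists_farEdgeBound_of_isRegular (n : ℕ) :
    ∃ κ : ℝ, 0 < κ ∧ ∀ [NeZero n] (T : ConvexPolygon n), T.IsRegular → T.diam = 1 →
      T.FarEdgeBound κ := by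
  set β : Fin n → ℝ := fun i => 2 * Real.pi * (i : ℕ) / n with hβ
  -- Twice the signed area of a triangle inscribed in the unit circle at these angles. For fixed `n`
  -- there are finitely many triples, so the positive values have a positive minimum.
  set G : Fin n × Fin n × Fin n → ℝ := fun p =>
    Real.sin (β p.2.2 - β p.2.1) + Real.sin (β p.2.1 - β p.1) - Real.sin (β p.2.2 - β p.1) with hG
  have hmin : ∃ g : ℝ, 0 < g ∧ ∀ p, 0 < G p → g ≤ G p := by
    by_cases hne : (Finset.univ.filter fun p => 0 < G p).Nonempty
    · obtain ⟨p, hp, hle⟩ := Finset.exists_min_image _ G hne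
      exact ⟨G p, (Finset.mem_filter.1 hp).2, fun q hq =>
        hle q (Finset.mem_filter.2 ⟨Finset.mem_univ _, hq⟩)⟩
    · refine ⟨1, one_pos, fun p hp => absurd ⟨p, ?_⟩ hne⟩
      exact Finset.mem_filter.2 ⟨Finset.mem_univ _, hp⟩
  obtain ⟨g, hg, hle⟩ := hmin
  -- The area is at least R²g and an edge is at most 2R long, so the distance is at least Rg/2,
  -- where R ≥ 1/2.
  refine ⟨g / 4, by positivity, fun T hreg hdiam i j h h' => ?_⟩
  obtain ⟨c, R, φ, hR, ha⟩ := hreg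
  have hdist : ∀ k, dist (T.a k) c = R := by
    intro k
    have h1 : ‖(!₂[Real.cos (φ + 2 * Real.pi * (k : ℕ) / n),
        Real.sin (φ + 2 * Real.pi * (k : ℕ) / n)] : Plane)‖ = 1 := by
      rw [EuclideanSpace.norm_eq, Fin.sum_univ_two]
      simp
    rw [ha k, dist_eq_norm, add_sub_cancel_left, norm_smul, h1, mul_one, Real.norm_eq_abs,
      abs_of_pos hR]
  have hR2 : 1 / 2 ≤ R := by
    have hsub : T.carrier ⊆ Metric.closedBall c R := by
      refine convexHull_min ?_ (convex_closedBall c R)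
      rintro _ ⟨k, rfl⟩
      exact (hdist k).le
    have := Metric.diam_le_of_subset_closedBall hR.le hsub
    change T.diam ≤ _ at this
    linarith
  have hcross : cross (T.a (j + 1) - T.a j) (T.a i - T.a j) = R ^ 2 * G (j, j + 1, i) := by
    rw [ha i, ha j, ha (j + 1)]
    simp only [hG, hβ]
    rw [← add_sub_add_left_eq_sub (2 * Real.pi * ((i : ℕ) : ℝ) / n) _ φ,
      ← add_sub_add_left_eq_sub (2 * Real.pi * ((j + 1 : Fin n) : ℝ) / n) _ φ,
      ← add_sub_add_left_eq_sub (2 * Real.pi * ((i : ℕ) : ℝ) / n) _ φ,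
      Real.sin_sub, Real.sin_sub, Real.sin_sub]
    simp [cross]
    ring
  have hj : i ≠ j + 1 := by
    rintro rfl
    exact h (add_sub_one j).symm
  have hG0 : g ≤ G (j, j + 1, i) := by
    apply hle
    have := T.convex j i h'.symm hj
    rw [hcross] at this
    exact pos_of_mul_pos_right this (by positivity)
  have hedge : ‖T.a (j + 1) - T.a j‖ ≤ 2 * R := by
    rw [← dist_eq_norm]
    have := dist_triangle_right (T.a (j + 1)) (T.a j) c
    rw [hdist, hdist] at this
    linarith
  have he := T.edge_norm_pos j
  rw [edgeDist_eq_cross, hcross, inv_mul_eq_div, le_div_iff₀ he]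
  calc g / 4 * ‖T.a (j + 1) - T.a j‖ ≤ g / 4 * (2 * R) := by gcongr
    _ = (1 / 2) * R * g := by ring
    _ ≤ R * R * G (j, j + 1, i) := by gcongr
    _ = _ := by ring

end ConvexPolygon

theorem exists_pos_le_of_le (f : ℕ → ℝ) (hf : ∀ n, 0 < f n) (N : ℕ) :
    ∃ c, 0 < c ∧ ∀ n ≤ N, c ≤ f n := by
  obtain ⟨m, -, hm⟩ := Finset.exists_min_image (Finset.range (N + 1)) f ⟨0, by simp⟩
  exact ⟨f m, hf m, fun n hn => hm n (by simpa [Nat.lt_succ_iff] using hn)⟩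

theorem mainTheorem4 (C₁ C₂ θmax : ℝ) (hC₁ : 0 < C₁) (hC₂ : 0 < C₂) (hθ : θmax < Real.pi) :
    ∃ c C : ℝ, 0 < c ∧ 0 < C ∧
      ∀ (n : ℕ) [NeZero n] (ref T : ConvexPolygon n),
        ref.IsRegular → ref.diam = 1 →
        T.diam ≤ C₁ * T.inDiam →
        C₂ * T.diam ≤ T.minEdgeDist →
        (∀ i : Fin n, T.interiorAngle i ≤ θmax) →
        ∀ x ∈ ref.carrier,
          DifferentiableAt ℝ (ConvexPolygon.wachspressMap ref T) x ∧
          c * T.diam ^ 2 ≤ (jacobianMatrix (ConvexPolygon.wachspressMap ref T) x).det ∧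
          (jacobianMatrix (ConvexPolygon.wachspressMap ref T) x).det ≤ C * T.diam ^ 2 := by
  obtain ⟨N, hN⟩ := ConvexPolygon.exists_card_bound hC₂
  choose κ hκ hreg using ConvexPolygon.exists_farEdgeBound_of_isRegular
  set lower : ℕ → ℝ := fun n => (κ n * (κ n / n) ^ n) ^ 3 * κ n ^ 2 / (12 * n ^ 3) * C₂ ^ 2
  set upper : ℕ → ℝ := fun n => (n * ((n + n ^ 2) / (κ n * (κ n / n) ^ n))) ^ 2
  -- `lower 0` is 0 because division by zero gives 0; the value 1 there keeps the family positive.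
  obtain ⟨c, hc, hcle⟩ := exists_pos_le_of_le (fun n => if n = 0 then 1 else lower n) (fun n => by
    have := hκ n
    split_ifs with h
    · exact one_pos
    · have hn : (0 : ℝ) < n := by exact_mod_cast Nat.pos_of_ne_zero h
      positivity) N
  -- A positive lower bound for the reciprocals is an upper bound for `upper`; adding 1 ensures
  -- positivity, as `upper 0` is 0.
  obtain ⟨d, hd, hdle⟩ := exists_pos_le_of_le (fun n => (1 + upper n)⁻¹) (fun n => by positivity) N
  refine ⟨c, d⁻¹, hc, inv_pos.2 hd, fun n _ ref T href hdiam _ hmin _ x hx => ?_⟩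
  have hT : T.FarEdgeBound (C₂ * T.diam) := T.farEdgeBound_minEdgeDist.mono hmin
  have hnN := hN n T hT
  have hb := hreg n ref href hdiam
  have hT0 := T.diam_pos
  refine ⟨(ConvexPolygon.contDiffAt_wachspressMap ref T (ConvexPolygon.sum_weight_pos (hκ n) hb
    hdiam.le hx).ne').differentiableAt one_ne_zero, ?_, ?_⟩
  · have h1 := ConvexPolygon.le_det_jacobianMatrix (hκ n) hb hdiam.le hx
      (mul_pos hC₂ hT0).le hT
    have h2 := hcle n hnN
    rw [if_neg (NeZero.ne n)] at h2
    refine le_trans ?_ h1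
    calc c * T.diam ^ 2 ≤ lower n * T.diam ^ 2 := by gcongr
      _ = _ := by simp only [lower]; ring
  · refine (ConvexPolygon.det_jacobianMatrix_le (hκ n) hb hdiam.le hx T).trans ?_
    have h2 := hdle n hnN
    have h3 : 1 + upper n ≤ d⁻¹ := by
      have h0 : 0 < 1 + upper n := by positivity
      exact (le_inv_comm₀ hd h0).1 h2
    have h4 : upper n ≤ d⁻¹ := by linarith
    exact mul_le_mul_of_nonneg_right h4 (by positivity)
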